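/- Let $K$ be a compact Hausdorff space, let $\mathrm{C}(K)$ be the Banach lattice of continuous complex-valued functions on $K$, and identify the dual $\mathrm{C}(K)'$ with the space of complex regular Borel measures on $K$. A bounded linear operator $T$ on $\mathrm{C}(K)$ is called Markov if it is positive and $T\mathbb{1}=\mathbb{1}$. Let $\mathcal{S}\subset\mathscr{L}(\mathrm{C}(K))$ be a semigroup (under composition) of Markov operators which, endowed with the strong operator topology, is right amenable, i.e., there is a positive functional $m\in \mathrm{C}_{\mathrm{b}}(\mathcal{S})'$ with $m(\mathbb{1})=1$ and $m(R_SF)=m(F)$ for all $F\in\mathrm{C}_{\mathrm{b}}(\mathcal{S})$ and $S\in\mathcal{S}$, where $(R_SF)(T):=F(TS)$. Let $\mathrm{P}_{\mathcal{S}}(K)\subset\mathrm{C}(K)'$ be the convex set of all regular Borel probability measures $\mu$ on $K$ that are invariant, i.e., $S'\mu=\mu$ for every $S\in\mathcal{S}$. For $\mu\in\mathrm{P}_{\mathcal{S}}(K)$ and $S\in\mathcal{S}$, let $S_\mu$ be the unique bounded operator on the complex space $\mathrm{L}^1(K,\mu)$ that maps the class of $f$ to the class of $Sf$ for every $f\in\mathrm{C}(K)$,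 and call $\mu$ ergodic if the fixed space $$\{f\in\mathrm{L}^1(K,\mu) \mid S_\mu f=f \text{ for all } S\in\mathcal{S}\}$$ is one-dimensional. Then a measure $\mu\in\mathrm{P}_{\mathcal{S}}(K)$ is ergodic if and only if $\mu$ is an extreme point of $\mathrm{P}_{\mathcal{S}}(K)$. -/

import Mathlib

open MeasureTheory
open scoped BoundedContinuousFunction

set_option linter.unusedSectionVars false

namespace MarkovSemigroup

/-! Throughout, `K` is a compact Hausdorff space and `C(K, ℂ)` is the Banach lattice of continuous
complex-valued functions on `K`. -/

section Operators

open scoped ComplexOrder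

variable {K : Type*} [TopologicalSpace K] [CompactSpace K]

/-- A bounded operator `T` on `C(K)` is *Markov* if it is positive and `T 1 = 1`.
(For complex numbers `0 ≤ z` means that `z` is a nonnegative real number.) -/
structure IsMarkov (T : C(K, ℂ) →L[ℂ] C(K, ℂ)) : Prop where
  pos : ∀ f : C(K, ℂ), (∀ x, 0 ≤ f x) → ∀ x, 0 ≤ T f x
  map_one : T 1 = 1

/-- The semigroup `𝒮` as a space of its own, to be endowed with the strong operator topology
(and not with the norm topology). -/
def WithSOT (𝒮 : Subsemigroup (C(K, ℂ) →L[ℂ] C(K, ℂ))) : Type _ := 𝒮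

namespace WithSOT

variable {𝒮 : Subsemigroup (C(K, ℂ) →L[ℂ] C(K, ℂ))}

/-- The underlying operator of an element of the semigroup. -/
noncomputable def op (T : WithSOT 𝒮) : C(K, ℂ) →L[ℂ] C(K, ℂ) := Subtype.val T

/-- The product is the composition of operators. -/
noncomputable instance instMul : Mul (WithSOT 𝒮) := inferInstanceAs (Mul 𝒮)

/-- The strong operator topology: the initial topology with respect to the evaluations
`T ↦ T f`, where `f ∈ C(K)` and `C(K)` carries the norm topology. -/
noncomputable instance instTopologicalSpace : TopologicalSpace (WithSOT 𝒮) :=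
  TopologicalSpace.induced (fun T (f : C(K, ℂ)) => T.op f) inferInstance

theorem op_mul_apply (T S : WithSOT 𝒮) (f : C(K, ℂ)) : (T * S).op f = T.op (S.op f) := rfl

theorem continuous_op_apply (f : C(K, ℂ)) : Continuous fun T : WithSOT 𝒮 => T.op f :=
  (continuous_apply f).comp
    (continuous_induced_dom (f := fun (T : WithSOT 𝒮) (f : C(K, ℂ)) => T.op f))

theorem continuous_mul_right (S : WithSOT 𝒮) : Continuous fun T : WithSOT 𝒮 => T * S :=
  continuous_induced_rng.2 (continuous_pi fun f => continuous_op_apply (S.op f))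

/-- Right translation `(R_S F)(T) = F (T S)` on the bounded continuous functions on the
semigroup. -/
noncomputable def rightTranslate (S : WithSOT 𝒮) (F : WithSOT 𝒮 →ᵇ ℂ) : WithSOT 𝒮 →ᵇ ℂ :=
  F.compContinuous ⟨fun T => T * S, continuous_mul_right S⟩

end WithSOT

/-- `𝒮`, endowed with the strong operator topology, is *right amenable*: there is a positive
normalized functional `m` on `C_b(𝒮)` which is invariant under all right translations. -/
def IsRightAmenable (𝒮 : Subsemigroup (C(K, ℂ) →L[ℂ] C(K, ℂ))) : Prop :=
  ∃ m : StrongDual ℂ (WithSOT 𝒮 →ᵇ ℂ),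
    (∀ F : WithSOT 𝒮 →ᵇ ℂ, (∀ T, 0 ≤ F T) → 0 ≤ m F) ∧
    m 1 = 1 ∧
    ∀ (S : WithSOT 𝒮) (F : WithSOT 𝒮 →ᵇ ℂ), m (S.rightTranslate F) = m F

end Operators

section Measures

variable {K : Type*} [TopologicalSpace K] [CompactSpace K] [MeasurableSpace K] [BorelSpace K]

/-- A finite Borel measure `μ` seen as the functional `f ↦ ∫ f dμ` in the dual of `C(K)`. -/
noncomputable def toDual (μ : Measure K) [IsFiniteMeasure μ] : StrongDual ℂ C(K, ℂ) :=
  (L1.integralCLM' ℂ).comp (ContinuousMap.toLp 1 μ ℂ)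

theorem toDual_apply (μ : Measure K) [IsFiniteMeasure μ] (f : C(K, ℂ)) :
    toDual μ f = ∫ x, f x ∂μ := by
  have h := integral_congr_ae (ContinuousMap.coeFn_toLp (p := 1) (𝕜 := ℂ) μ f)
  rw [← h, ← L1.integral_eq_integral, L1.integral_eq' ℂ]
  rfl

/-- The set `P_𝒮(K)` of `𝒮`-invariant regular Borel probability measures on `K`, as a subset of
the dual of `C(K)`. Invariance of `φ` means `S' φ = φ ∘ S = φ` for all `S ∈ 𝒮`. -/
def invariantProbabilities (𝒮 : Subsemigroup (C(K, ℂ) →L[ℂ] C(K, ℂ))) :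
    Set (StrongDual ℂ C(K, ℂ)) :=
  {φ | (∃ (μ : Measure K) (_ : IsProbabilityMeasure μ), μ.Regular ∧ toDual μ = φ) ∧
    ∀ S ∈ 𝒮, φ.comp S = φ}

/-- The operator `S_μ` on `L¹(K, μ)` induced by an operator `S` on `C(K)`: the continuous extension
of `[f] ↦ [S f]` from the image of `C(K)` (that is, from `C(K) / I_μ`) to `L¹(K, μ)`. It exists
for a Markov operator `S` that leaves `μ` invariant, see `induced_toLp`. -/
noncomputable def induced (μ : Measure K) [IsFiniteMeasure μ] (S : C(K, ℂ) →L[ℂ] C(K, ℂ)) :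
    Lp ℂ 1 μ →L[ℂ] Lp ℂ 1 μ :=
  ((ContinuousMap.toLp 1 μ ℂ).comp S).toLinearMap.extendOfNorm
    (ContinuousMap.toLp 1 μ ℂ : C(K, ℂ) →L[ℂ] Lp ℂ 1 μ).toLinearMap

/-- The semigroup `𝒮_μ = {S_μ | S ∈ 𝒮}` induced by `𝒮` on `L¹(K, μ)`. -/
def inducedSemigroup (𝒮 : Subsemigroup (C(K, ℂ) →L[ℂ] C(K, ℂ))) (μ : Measure K)
    [IsFiniteMeasure μ] : Set (Lp ℂ 1 μ →L[ℂ] Lp ℂ 1 μ) :=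
  induced μ '' 𝒮

/-- The fixed space of a family of operators. -/
def fixedSpace {E : Type*} [NormedAddCommGroup E] [NormedSpace ℂ E] (𝒯 : Set (E →L[ℂ] E)) :
    Submodule ℂ E where
  carrier := {f | ∀ T ∈ 𝒯, T f = f}
  add_mem' hf hg T hT := by rw [map_add, hf T hT, hg T hT]
  zero_mem' T _ := map_zero T
  smul_mem' c f hf T hT := by rw [map_smul, hf T hT]

/-- `μ` is *ergodic* if the fixed space of `𝒮_μ` in `L¹(K, μ)` is one-dimensional. -/
def IsErgodic (𝒮 : Subsemigroup (C(K, ℂ) →L[ℂ] C(K, ℂ))) (μ : Measure K) [IsFiniteMeasure μ] :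
    Prop :=
  Module.finrank ℂ (fixedSpace (inducedSemigroup 𝒮 μ)) = 1

/-! The induced operators are well defined. -/

section WellDefined

open scoped ComplexOrder

/-- The modulus `|f|` of `f ∈ C(K)`. -/
noncomputable def modulus (f : C(K, ℂ)) : C(K, ℂ) := ⟨fun x => (‖f x‖ : ℂ), by fun_prop⟩

theorem IsMarkov.im_eq_zero {S : C(K, ℂ) →L[ℂ] C(K, ℂ)} (hS : IsMarkov S) {g : C(K, ℂ)}
    (hg : ∀ x, (g x).im = 0) (x : K) : (S g x).im = 0 := by
  have h1 := hS.pos (modulus g) (fun y => by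
    simp [modulus, Complex.le_def]) x
  have h2 := hS.pos (modulus g - g) (fun y => by
    simp only [modulus, Complex.le_def, ContinuousMap.sub_apply, ContinuousMap.coe_mk]
    have := Complex.re_le_norm (g y)
    simp [hg y, this]) x
  rw [map_sub, ContinuousMap.sub_apply] at h2
  have h3 := (Complex.le_def.1 h1).2
  have h4 := (Complex.le_def.1 h2).2
  simp only [Complex.zero_im, Complex.sub_im] at h3 h4
  linarith

theorem IsMarkov.norm_apply_le {S : C(K, ℂ) →L[ℂ] C(K, ℂ)} (hS : IsMarkov S) (f : C(K, ℂ))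
    (x : K) : ‖S f x‖ ≤ (S (modulus f) x).re := by
  obtain ⟨c, hc, hcx⟩ : ∃ c : ℂ, ‖c‖ = 1 ∧ ‖S f x‖ = c * S f x := by
    obtain ⟨c, hc, h⟩ := RCLike.exists_norm_eq_mul_self (S f x)
    exact ⟨c, hc, h⟩
  let u : C(K, ℂ) := ⟨fun y => ((c * f y).re : ℂ), by fun_prop⟩
  let v : C(K, ℂ) := ⟨fun y => ((c * f y).im : ℂ), by fun_prop⟩
  have huv : c • f = u + Complex.I • v := by
    ext y
    simp only [u, v, ContinuousMap.smul_apply, ContinuousMap.add_apply, ContinuousMap.coe_mk,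
      smul_eq_mul]
    rw [mul_comm Complex.I, Complex.re_add_im]
  have h1 := hS.pos (modulus f - u) (fun y => by
    simp only [modulus, u, Complex.le_def, ContinuousMap.sub_apply, ContinuousMap.coe_mk]
    have := Complex.re_le_norm (c * f y)
    rw [norm_mul, hc, one_mul] at this
    refine ⟨?_, ?_⟩
    · rw [Complex.sub_re, Complex.ofReal_re, Complex.ofReal_re, Complex.zero_re]
      linarith
    · simp) x
  have hv := hS.im_eq_zero (g := v) (fun y => by simp [v]) x
  have h2 : (‖S f x‖ : ℂ) = S u x + Complex.I * S v x := by
    rw [hcx]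
    have := congrArg (fun g => S g x) huv
    simpa using this
  have h3 := congrArg Complex.re h2
  have h4 := (Complex.le_def.1 h1).1
  simp only [map_sub, ContinuousMap.sub_apply, Complex.zero_re, Complex.sub_re] at h4
  simp [hv] at h3
  linarith

theorem norm_toLp_eq (μ : Measure K) [IsFiniteMeasure μ] (f : C(K, ℂ)) :
    ‖(ContinuousMap.toLp 1 μ ℂ f : Lp ℂ 1 μ)‖ = ∫ x, ‖f x‖ ∂μ := by
  rw [L1.norm_eq_integral_norm]
  refine integral_congr_ae ?_
  filter_upwards [ContinuousMap.coeFn_toLp (p := 1) (𝕜 := ℂ) μ f] with x hx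
  rw [hx]

theorem norm_toLp_apply_le {S : C(K, ℂ) →L[ℂ] C(K, ℂ)} (hS : IsMarkov S) (μ : Measure K)
    [IsFiniteMeasure μ] (hμ : (toDual μ).comp S = toDual μ) (f : C(K, ℂ)) :
    ‖(ContinuousMap.toLp 1 μ ℂ (S f) : Lp ℂ 1 μ)‖ ≤
      ‖(ContinuousMap.toLp 1 μ ℂ f : Lp ℂ 1 μ)‖ := by
  have hint : ∀ g : C(K, ℂ), Integrable g μ := fun g =>
    (L1.integrable_coeFn _).congr (ContinuousMap.coeFn_toLp (p := 1) (𝕜 := ℂ) μ g)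
  rw [norm_toLp_eq, norm_toLp_eq]
  calc ∫ x, ‖S f x‖ ∂μ ≤ ∫ x, (S (modulus f) x).re ∂μ :=
        integral_mono (hint _).norm (hint _).re (hS.norm_apply_le f)
    _ = (∫ x, S (modulus f) x ∂μ).re := integral_re (hint _)
    _ = (∫ x, modulus f x ∂μ).re := by
        rw [← toDual_apply, ← toDual_apply]
        exact congrArg Complex.re (DFunLike.congr_fun hμ (modulus f))
    _ = ∫ x, ‖f x‖ ∂μ := by
        change (∫ x, ((‖f x‖ : ℝ) : ℂ) ∂μ).re = _
        rw [integral_complex_ofReal, Complex.ofReal_re]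

/-- For a Markov operator `S` leaving the regular measure `μ` invariant, `S_μ` does extend `S`. As
`C(K)` is dense in `L¹(K, μ)`, it is the only continuous operator that does. -/
theorem induced_toLp [T2Space K] {S : C(K, ℂ) →L[ℂ] C(K, ℂ)} (hS : IsMarkov S) (μ : Measure K)
    [IsFiniteMeasure μ] [μ.Regular] (hμ : (toDual μ).comp S = toDual μ) (f : C(K, ℂ)) :
    induced μ S (ContinuousMap.toLp 1 μ ℂ f) = ContinuousMap.toLp 1 μ ℂ (S f) := by
  have hdense : DenseRange
      (ContinuousMap.toLp 1 μ ℂ : C(K, ℂ) →L[ℂ] Lp ℂ 1 μ).toLinearMap :=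
    ContinuousMap.toLp_denseRange ℂ μ ℂ ENNReal.one_ne_top
  have hnorm : ∃ C : ℝ, ∀ g : C(K, ℂ),
      ‖((ContinuousMap.toLp 1 μ ℂ : C(K, ℂ) →L[ℂ] Lp ℂ 1 μ).comp S).toLinearMap g‖ ≤
        C * ‖(ContinuousMap.toLp 1 μ ℂ : C(K, ℂ) →L[ℂ] Lp ℂ 1 μ).toLinearMap g‖ := by
    refine ⟨1, fun g => ?_⟩
    rw [one_mul]
    exact norm_toLp_apply_le hS μ hμ g
  exact LinearMap.extendOfNorm_eq hdense hnorm f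

end WellDefined

end Measures

end MarkovSemigroup

/-! Both directions rest on a Hilbert space fact: a contraction and its adjoint have the same fixed
vectors. By the Kadison–Schwarz inequality and invariance of `μ`, each `S` extends to a contraction
of `L²(μ)`. Hence for `h ∈ L²` the functional `f ↦ ∫ f h̄ dμ` is invariant exactly when `h` is fixed
by every `S_μ` (`inner_toLp_invariant_iff`).

If `μ` is ergodic and `μ = a μ₁ + b μ₂`, then `μ₁ ≤ a⁻¹ μ`, so `μ₁` has an `L²` density. It is
fixed, hence constant, and `μ₁ = μ`.

Conversely, let `μ` be extreme and `f ∈ L¹` fixed with mean zero. By Jensen's inequality and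
preservation of the integral, positive parts of real parts of fixed elements are fixed
(`induced_compLp_eq`), so the truncation `k = min((Re af)⁺, 1)` is a bounded fixed density. With `κ
= ∫ k dμ`, the measures `(1 ± (k - κ)) μ` are invariant probabilities with midpoint `μ`, so `k` is
constant. Thus `Re af` is nonpositive a.e. or positive a.e., and mean zero leaves the former;
varying `a` gives `f = 0`. -/

/-! ### Fixed vectors of contractions; regularity of dominated measures. -/

theorem ContinuousLinearMap.forall_inner_apply_eq_iff {𝕜 E : Type*} [RCLike 𝕜]
    [NormedAddCommGroup E] [InnerProductSpace 𝕜 E] [CompleteSpace E] {T : E →L[𝕜] E}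
    (hT : ‖T‖ ≤ 1) {x : E} :
    (∀ y, inner 𝕜 x (T y) = inner 𝕜 x y) ↔ T x = x := by
  -- Equality case: `‖Ax - x‖² = ‖Ax‖² - 2 Re⟨Ax, x⟩ + ‖x‖² ≤ 0`. The adjoint is again a
  -- contraction, which gives the converse.
  have key : ∀ A : E →L[𝕜] E, ‖A‖ ≤ 1 → (∀ y, inner 𝕜 x (A y) = inner 𝕜 x y) → A x = x := by
    intro A hA h
    refine eq_of_norm_le_re_inner_eq_norm_sq (𝕜 := 𝕜) ?_ ?_
    · simpa using A.le_of_opNorm_le hA x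
    · rw [inner_re_symm, h x, inner_self_eq_norm_sq]
  refine ⟨key T hT, fun h y => ?_⟩
  have hadj : adjoint T x = x := by
    refine key (adjoint T) ?_ fun z => ?_
    · rwa [LinearIsometryEquiv.norm_map]
    · rw [adjoint_inner_right, h]
  rw [← adjoint_inner_left, hadj]

/-- A compact subset that exhausts `s` up to `ε` for `c • μ` does so for `ν`. This makes measures
with bounded density regular. -/
theorem MeasureTheory.Measure.InnerRegularCompactLTTop.of_le_smul {X : Type*} [TopologicalSpace X]
    [T2Space X] [MeasurableSpace X] [BorelSpace X] {μ ν : Measure X} [IsFiniteMeasure μ]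
    [μ.InnerRegularCompactLTTop] {c : ENNReal} (hc : c ≠ ⊤) (h : ν ≤ c • μ) :
    ν.InnerRegularCompactLTTop := by
  have hreg : (c • μ).InnerRegularCompactLTTop := inferInstance
  have hle : ∀ s, ν s ≤ (c • μ) s := h
  have hfin : ∀ s, (c • μ) s ≠ ⊤ := fun s => by
    simpa using ENNReal.mul_ne_top hc (measure_ne_top μ s)
  have hνfin : ∀ s, ν s ≠ ⊤ := fun s => ne_top_of_le_ne_top (hfin s) (hle s)
  refine ⟨fun s hs r hr => ?_⟩
  obtain ⟨C, hCs, hC, hlt⟩ := hs.1.exists_isCompact_lt_add (hfin s)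
    (ε := ν s - r) (tsub_pos_of_lt hr).ne'
  refine ⟨C, hCs, hC, ?_⟩
  have h1 : ν (s \ C) < ν s - r := by
    refine (hle _).trans_lt ?_
    rw [measure_sdiff hCs hC.measurableSet.nullMeasurableSet (hfin C)]
    exact ENNReal.sub_lt_of_lt_add (measure_mono hCs) (by rwa [add_comm])
  have h2 : ν s = ν C + ν (s \ C) := by
    rw [measure_add_sdiff hC.measurableSet.nullMeasurableSet, Set.union_eq_self_of_subset_left hCs]
  by_contra! hCr
  have h3 : ν s < r + (ν s - r) := by
    conv_lhs => rw [h2]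
    exact ENNReal.add_lt_add_of_le_of_lt (hνfin C) hCr h1
  rw [add_tsub_cancel_of_le hr.le] at h3
  exact lt_irrefl _ h3

namespace MarkovSemigroup

open scoped ComplexOrder ComplexConjugate

/-! ### Jensen-type inequalities for Markov operators -/

section Operators

variable {K : Type*} [TopologicalSpace K] [CompactSpace K] [MeasurableSpace K] [BorelSpace K]
  {S : C(K, ℂ) →L[ℂ] C(K, ℂ)}

/-- The composition of a continuous function on `ℂ` with an element of `C(K)`. -/
noncomputable def postcomp (φ : C(ℂ, ℝ)) (f : C(K, ℂ)) : C(K, ℂ) :=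
  ⟨fun x => (φ (f x) : ℂ), by fun_prop⟩

theorem postcomp_apply (φ : C(ℂ, ℝ)) (f : C(K, ℂ)) (x : K) : postcomp φ f x = (φ (f x) : ℂ) := rfl

theorem IsMarkov.postcomp_im (hS : IsMarkov S) (φ : C(ℂ, ℝ)) (f : C(K, ℂ)) (x : K) :
    (S (postcomp φ f) x).im = 0 :=
  hS.im_eq_zero (fun y => by simp [postcomp_apply]) x

theorem IsMarkov.postcomp_le (hS : IsMarkov S) {φ ψ : C(ℂ, ℝ)} (f : C(K, ℂ))
    (h : ∀ z, φ z ≤ ψ z) (x : K) : (S (postcomp φ f) x).re ≤ (S (postcomp ψ f) x).re := by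
  have h1 := hS.pos (postcomp ψ f - postcomp φ f) (fun y => by
    rw [ContinuousMap.sub_apply, postcomp_apply, postcomp_apply, ← Complex.ofReal_sub,
      Complex.zero_le_real, sub_nonneg]
    exact h _) x
  have h2 := (Complex.le_def.1 h1).1
  simpa using h2

/-- Equality in Jensen: `S` fixes constants and maps real functions to real ones, so it commutes
with taking the real part of `a f`. -/
theorem IsMarkov.postcomp_affine (hS : IsMarkov S) (a : ℂ) (r : ℝ) (f : C(K, ℂ)) (x : K) :
    (S (postcomp ⟨fun z => (a * z).re + r, by fun_prop⟩ f) x).re = (a * S f x).re + r := by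
  let u : C(K, ℂ) := postcomp ⟨fun z => (a * z).re, by fun_prop⟩ f
  let v : C(K, ℂ) := postcomp ⟨fun z => (a * z).im, by fun_prop⟩ f
  have huv : a • f = u + Complex.I • v := by
    ext y
    change a * f y = ((a * f y).re : ℂ) + Complex.I * ((a * f y).im : ℂ)
    rw [mul_comm Complex.I, Complex.re_add_im]
  have hu : postcomp ⟨fun z => (a * z).re + r, by fun_prop⟩ f = u + (r : ℂ) • (1 : C(K, ℂ)) := by
    ext y
    simp [u, postcomp_apply]
  have hv : (S v x).im = 0 := hS.postcomp_im _ f x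
  have h1 : a * S f x = S u x + Complex.I * S v x := by
    simpa using congrArg (fun g => S g x) huv
  rw [hu, h1]
  simp [hS.map_one, hv]

/-- Jensen's inequality for the maximum of an affine function and a constant. -/
theorem IsMarkov.max_le (hS : IsMarkov S) (a : ℂ) (r : ℝ) (f : C(K, ℂ)) (x : K) :
    max ((a * S f x).re - r) 0 ≤
      (S (postcomp ⟨fun z => max ((a * z).re - r) 0, by fun_prop⟩ f) x).re := by
  refine _root_.max_le ?_ ?_
  · rw [sub_eq_add_neg, ← hS.postcomp_affine a (-r) f x]
    exact hS.postcomp_le f (fun z => by simp [← sub_eq_add_neg]) x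
  · have h := hS.postcomp_le (φ := ⟨fun z => (0 * z).re + 0, by fun_prop⟩)
      (ψ := ⟨fun z => max ((a * z).re - r) 0, by fun_prop⟩) f (fun z => by simp) x
    rw [hS.postcomp_affine] at h
    simpa only [zero_mul, Complex.zero_re, add_zero] using h

/-- The Kadison–Schwarz inequality. -/
theorem IsMarkov.norm_sq_le (hS : IsMarkov S) (f : C(K, ℂ)) (x : K) :
    ‖S f x‖ ^ 2 ≤ (S (postcomp ⟨fun z => ‖z‖ ^ 2, by fun_prop⟩ f) x).re := by
  -- A variance argument: expanding `S((|f| - t)²)(x) ≥ 0` at this `t` gives `S(|f|²)(x) ≥ t²`, and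
  -- `t ≥ |S f(x)|`.
  set t := (S (modulus f) x).re
  have hnn : ∀ y, 0 ≤ (postcomp ⟨fun z => (‖z‖ - t) ^ 2, by fun_prop⟩ f) y := fun y => by
    rw [postcomp_apply, Complex.zero_le_real]
    exact sq_nonneg _
  have h1 := (Complex.le_def.1 (hS.pos _ hnn x)).1
  have h2 : postcomp ⟨fun z => (‖z‖ - t) ^ 2, by fun_prop⟩ f =
      postcomp ⟨fun z => ‖z‖ ^ 2, by fun_prop⟩ f - ((2 * t : ℝ) : ℂ) • modulus f +
        ((t ^ 2 : ℝ) : ℂ) • (1 : C(K, ℂ)) := by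
    ext y
    simp [postcomp_apply, modulus]
    ring
  rw [h2] at h1
  simp only [map_add, map_sub, map_smul, hS.map_one, ContinuousMap.add_apply,
    ContinuousMap.sub_apply, ContinuousMap.smul_apply, smul_eq_mul, Complex.add_re,
    Complex.sub_re, Complex.re_ofReal_mul, ContinuousMap.one_apply,
    Complex.zero_re, Complex.ofReal_re, mul_one] at h1
  have h3 : ‖S f x‖ ≤ t := hS.norm_apply_le f x
  have h4 : ‖S f x‖ ^ 2 ≤ t ^ 2 := pow_le_pow_left₀ (norm_nonneg _) h3 2
  have h5 : (S (modulus f) x).re = t := rfl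
  rw [h5] at h1
  nlinarith

end Operators

/-! ### Induced operators on `L²` and `L¹` -/

section Measures

variable {K : Type*} [TopologicalSpace K] [CompactSpace K] [MeasurableSpace K] [BorelSpace K]
  {S : C(K, ℂ) →L[ℂ] C(K, ℂ)} {μ : Measure K}

theorem integrable_continuousMap [IsFiniteMeasure μ] (f : C(K, ℂ)) : Integrable f μ :=
  (L1.integrable_coeFn _).congr (ContinuousMap.coeFn_toLp (p := 1) (𝕜 := ℂ) μ f)

theorem norm_toLp_two_sq [IsFiniteMeasure μ] (f : C(K, ℂ)) :
    ‖(ContinuousMap.toLp 2 μ ℂ f : Lp ℂ 2 μ)‖ ^ 2 = ∫ x, ‖f x‖ ^ 2 ∂μ := by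
  have h : ((‖(ContinuousMap.toLp 2 μ ℂ f : Lp ℂ 2 μ)‖ ^ 2 : ℝ) : ℂ) =
      ((∫ x, ‖f x‖ ^ 2 ∂μ : ℝ) : ℂ) := by
    have h0 := inner_self_eq_norm_sq_to_K (𝕜 := ℂ) (ContinuousMap.toLp 2 μ ℂ f : Lp ℂ 2 μ)
    rw [Complex.ofReal_pow]
    refine h0.symm.trans ?_
    rw [L2.inner_def, ← integral_complex_ofReal]
    refine integral_congr_ae ?_
    filter_upwards [ContinuousMap.coeFn_toLp (p := 2) (𝕜 := ℂ) μ f] with x hx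
    rw [hx, Complex.ofReal_pow]
    exact inner_self_eq_norm_sq_to_K (𝕜 := ℂ) (f x)
  exact_mod_cast h

/-- The Kadison–Schwarz inequality integrated against the invariant measure. -/
theorem norm_toLp_two_apply_le [IsFiniteMeasure μ] (hS : IsMarkov S)
    (hμ : (toDual μ).comp S = toDual μ) (f : C(K, ℂ)) :
    ‖(ContinuousMap.toLp 2 μ ℂ (S f) : Lp ℂ 2 μ)‖ ≤
      ‖(ContinuousMap.toLp 2 μ ℂ f : Lp ℂ 2 μ)‖ := by
  refine le_of_sq_le_sq ?_ (norm_nonneg _)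
  rw [norm_toLp_two_sq, norm_toLp_two_sq]
  let q : C(ℂ, ℝ) := ⟨fun z => ‖z‖ ^ 2, by fun_prop⟩
  have hsq : ∀ g : C(K, ℂ), Integrable (fun x => ‖g x‖ ^ 2) μ := fun g =>
    (integrable_continuousMap (postcomp q g)).re
  calc ∫ x, ‖S f x‖ ^ 2 ∂μ ≤ ∫ x, (S (postcomp q f) x).re ∂μ :=
        integral_mono (hsq _) (integrable_continuousMap _).re (hS.norm_sq_le f)
    _ = (∫ x, S (postcomp q f) x ∂μ).re := integral_re (integrable_continuousMap _)
    _ = (∫ x, postcomp q f x ∂μ).re := by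
        rw [← toDual_apply, ← toDual_apply]
        exact congrArg Complex.re (DFunLike.congr_fun hμ _)
    _ = ∫ x, ‖f x‖ ^ 2 ∂μ := by
        change (∫ x, ((‖f x‖ ^ 2 : ℝ) : ℂ) ∂μ).re = _
        rw [integral_complex_ofReal, Complex.ofReal_re]

/-- The inclusion of `L²` into `L¹` over a probability measure. -/
noncomputable def l2ToL1 (μ : Measure K) [IsProbabilityMeasure μ] : Lp ℂ 2 μ →L[ℂ] Lp ℂ 1 μ :=
  LinearMap.mkContinuous
    { toFun := fun f => ((Lp.memLp f).mono_exponent one_le_two).toLp f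
      map_add' := fun f g => by
        rw [← MemLp.toLp_add]
        exact MemLp.toLp_congr _ _ (Lp.coeFn_add f g)
      map_smul' := fun c f => by
        rw [RingHom.id_apply, ← MemLp.toLp_const_smul]
        exact MemLp.toLp_congr _ _ (Lp.coeFn_smul c f) } 1 fun f => by
    rw [one_mul]
    change ‖((Lp.memLp f).mono_exponent one_le_two).toLp f‖ ≤ _
    rw [Lp.norm_toLp, Lp.norm_def]
    exact ENNReal.toReal_mono (Lp.eLpNorm_ne_top f)
      (eLpNorm_le_eLpNorm_of_exponent_le one_le_two (Lp.aestronglyMeasurable f))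

theorem coeFn_l2ToL1 [IsProbabilityMeasure μ] (f : Lp ℂ 2 μ) : l2ToL1 μ f =ᵐ[μ] f :=
  MemLp.coeFn_toLp ((Lp.memLp f).mono_exponent one_le_two)

theorem l2ToL1_injective [IsProbabilityMeasure μ] : Function.Injective (l2ToL1 μ) := by
  intro f g h
  have hf := coeFn_l2ToL1 f
  rw [h] at hf
  exact Lp.ext (hf.symm.trans (coeFn_l2ToL1 g))

theorem l2ToL1_toLp [IsProbabilityMeasure μ] (f : C(K, ℂ)) :
    l2ToL1 μ (ContinuousMap.toLp 2 μ ℂ f) = ContinuousMap.toLp 1 μ ℂ f :=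
  Lp.ext ((coeFn_l2ToL1 _).trans ((ContinuousMap.coeFn_toLp μ f).trans
    (ContinuousMap.coeFn_toLp μ f).symm))

theorem inner_toLp [IsFiniteMeasure μ] (h : Lp ℂ 2 μ) (f : C(K, ℂ)) :
    inner ℂ h (ContinuousMap.toLp 2 μ ℂ f : Lp ℂ 2 μ) = ∫ x, f x * conj (h x) ∂μ := by
  rw [L2.inner_def]
  refine integral_congr_ae ?_
  filter_upwards [ContinuousMap.coeFn_toLp (p := 2) (𝕜 := ℂ) μ f] with x hx
  rw [hx, RCLike.inner_apply]

variable [T2Space K] [IsProbabilityMeasure μ] [μ.Regular]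

/-- A density in `L²` defines an invariant functional on `C(K)` if and only if it is fixed by the
induced operator on `L¹`. -/
theorem inner_toLp_invariant_iff (hS : IsMarkov S) (hμ : (toDual μ).comp S = toDual μ)
    (h : Lp ℂ 2 μ) :
    (∀ f : C(K, ℂ), inner ℂ h (ContinuousMap.toLp 2 μ ℂ (S f) : Lp ℂ 2 μ) =
      inner ℂ h (ContinuousMap.toLp 2 μ ℂ f : Lp ℂ 2 μ)) ↔
      induced μ S (l2ToL1 μ h) = l2ToL1 μ h := by
  have hdense : DenseRange (ContinuousMap.toLp 2 μ ℂ : C(K, ℂ) →L[ℂ] Lp ℂ 2 μ).toLinearMap :=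
    ContinuousMap.toLp_denseRange ℂ μ ℂ ENNReal.ofNat_ne_top
  have hnorm : ∀ g : C(K, ℂ),
      ‖((ContinuousMap.toLp 2 μ ℂ : C(K, ℂ) →L[ℂ] Lp ℂ 2 μ).comp S).toLinearMap g‖ ≤
        1 * ‖(ContinuousMap.toLp 2 μ ℂ : C(K, ℂ) →L[ℂ] Lp ℂ 2 μ).toLinearMap g‖ := by
    intro g
    rw [one_mul]
    exact norm_toLp_two_apply_le hS hμ g
  let T := ((ContinuousMap.toLp 2 μ ℂ : C(K, ℂ) →L[ℂ] Lp ℂ 2 μ).comp S).toLinearMap.extendOfNorm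
    (ContinuousMap.toLp 2 μ ℂ : C(K, ℂ) →L[ℂ] Lp ℂ 2 μ).toLinearMap
  have hT : ‖T‖ ≤ 1 := LinearMap.opNorm_extendOfNorm_le hdense zero_le_one hnorm
  have hTf : ∀ f : C(K, ℂ), T (ContinuousMap.toLp 2 μ ℂ f) = ContinuousMap.toLp 2 μ ℂ (S f) :=
    fun f => LinearMap.extendOfNorm_eq hdense ⟨1, hnorm⟩ f
  have hcomm : ∀ g : Lp ℂ 2 μ, l2ToL1 μ (T g) = induced μ S (l2ToL1 μ g) := by
    intro g
    refine DenseRange.induction_on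
      (p := fun g => l2ToL1 μ (T g) = induced μ S (l2ToL1 μ g)) hdense g
      (isClosed_eq (by fun_prop) (by fun_prop)) fun f => ?_
    change l2ToL1 μ (T (ContinuousMap.toLp 2 μ ℂ f)) =
      induced μ S (l2ToL1 μ (ContinuousMap.toLp 2 μ ℂ f))
    rw [hTf, l2ToL1_toLp, l2ToL1_toLp, induced_toLp hS μ hμ]
  -- Invariance of the functional says that the adjoint of `T` fixes `h`; since `T` is a
  -- contraction, this is the same as `T h = h`.
  rw [← hcomm, l2ToL1_injective.eq_iff, ← ContinuousLinearMap.forall_inner_apply_eq_iff hT]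
  constructor
  · intro H y
    refine DenseRange.induction_on (p := fun y => inner ℂ h (T y) = inner ℂ h y) hdense y
      (isClosed_eq (by fun_prop) (by fun_prop)) fun f => ?_
    change inner ℂ h (T (ContinuousMap.toLp 2 μ ℂ f)) = _
    rw [hTf]
    exact H f
  · intro H f
    rw [← hTf]
    exact H _

theorem integral_induced (hS : IsMarkov S) (hμ : (toDual μ).comp S = toDual μ) (f : Lp ℂ 1 μ) :
    L1.integralCLM' ℂ (induced μ S f) = L1.integralCLM' ℂ f := by
  refine DenseRange.induction_on
    (p := fun f => L1.integralCLM' ℂ (induced μ S f) = L1.integralCLM' ℂ f)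
    (ContinuousMap.toLp_denseRange ℂ μ ℂ ENNReal.one_ne_top) f
    (isClosed_eq (by fun_prop) (by fun_prop)) fun f => ?_
  rw [induced_toLp hS μ hμ]
  exact DFunLike.congr_fun hμ f

/-- If a pointwise Jensen inequality holds for `φ` on `C(K)`, then composition with `φ` preserves
the fixed space of the induced operator. -/
theorem induced_compLp_eq (hS : IsMarkov S) (hμ : (toDual μ).comp S = toDual μ) {φ : C(ℂ, ℝ)}
    {c : NNReal} (hφ : LipschitzWith c (fun z => (φ z : ℂ))) (h0 : (φ 0 : ℂ) = 0)
    (hle : ∀ (f : C(K, ℂ)) x, φ (S f x) ≤ (S (postcomp φ f) x).re)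
    {f : Lp ℂ 1 μ} (hf : induced μ S f = f) :
    induced μ S (hφ.compLp h0 f) = hφ.compLp h0 f := by
  have hcont : Continuous (hφ.compLp h0 : Lp ℂ 1 μ → Lp ℂ 1 μ) := hφ.continuous_compLp h0
  have hφf : ∀ g : C(K, ℂ), hφ.compLp h0 (ContinuousMap.toLp 1 μ ℂ g : Lp ℂ 1 μ) =
      ContinuousMap.toLp 1 μ ℂ (postcomp φ g) := fun g => by
    refine Lp.ext ((hφ.coeFn_compLp h0 _).trans ?_)
    filter_upwards [ContinuousMap.coeFn_toLp (p := 1) (𝕜 := ℂ) μ g,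
      ContinuousMap.coeFn_toLp (p := 1) (𝕜 := ℂ) μ (postcomp φ g)] with x hx hx'
    rw [hx', Function.comp_apply, hx, postcomp_apply]
  -- On `C(K)` the difference is nonnegative by `hle`, so its norm is its integral. Both sides are
  -- continuous in `g` because `φ` is Lipschitz, so the identity passes to `L¹`. For fixed `f` the
  -- integral vanishes.
  have key : ∀ g : Lp ℂ 1 μ,
      ((‖induced μ S (hφ.compLp h0 g) - hφ.compLp h0 (induced μ S g)‖ : ℝ) : ℂ) =
      L1.integralCLM' ℂ (induced μ S (hφ.compLp h0 g) - hφ.compLp h0 (induced μ S g)) := by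
    intro g
    refine DenseRange.induction_on (p := fun g : Lp ℂ 1 μ =>
      ((‖induced μ S (hφ.compLp h0 g) - hφ.compLp h0 (induced μ S g)‖ : ℝ) : ℂ) =
      L1.integralCLM' ℂ (induced μ S (hφ.compLp h0 g) - hφ.compLp h0 (induced μ S g)))
      (ContinuousMap.toLp_denseRange ℂ μ ℂ ENNReal.one_ne_top) g
      (isClosed_eq (by fun_prop) (by fun_prop)) fun g => ?_
    rw [hφf, induced_toLp hS μ hμ, induced_toLp hS μ hμ, hφf, ← map_sub, norm_toLp_eq,
      ← integral_complex_ofReal]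
    refine Eq.trans ?_ (toDual_apply μ _).symm
    refine integral_congr_ae (Filter.Eventually.of_forall fun x => ?_)
    have hx : (S (postcomp φ g) - postcomp φ (S g)) x =
        (((S (postcomp φ g) x).re - φ (S g x) : ℝ) : ℂ) := by
      rw [ContinuousMap.sub_apply, postcomp_apply, Complex.ofReal_sub]
      congr 1
      exact Complex.ext rfl (hS.postcomp_im φ g x)
    simp only [hx, Complex.norm_real, Real.norm_eq_abs]
    rw [abs_of_nonneg (sub_nonneg.2 (hle g x))]
  have h := key f
  rw [hf, map_sub, integral_induced hS hμ, sub_self, Complex.ofReal_eq_zero, norm_eq_zero,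
    sub_eq_zero] at h
  exact h

end Measures

/-! ### Ergodicity and extremality -/

section Ergodic

variable {K : Type*} [TopologicalSpace K] [CompactSpace K] [T2Space K] [MeasurableSpace K]
  [BorelSpace K] {S : C(K, ℂ) →L[ℂ] C(K, ℂ)} {𝒮 : Subsemigroup (C(K, ℂ) →L[ℂ] C(K, ℂ))}
  {μ : Measure K}

theorem toDual_one [IsProbabilityMeasure μ] : toDual μ 1 = 1 := by
  rw [toDual_apply]
  simp

theorem toDual_modulus [IsFiniteMeasure μ] (f : C(K, ℂ)) :
    toDual μ (modulus f) = ((∫ x, ‖f x‖ ∂μ : ℝ) : ℂ) := by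
  rw [toDual_apply, ← integral_complex_ofReal]
  rfl

variable [IsProbabilityMeasure μ]

theorem toLp_one_ne_zero : (ContinuousMap.toLp 1 μ ℂ 1 : Lp ℂ 1 μ) ≠ 0 := by
  rw [← norm_ne_zero_iff, norm_toLp_eq]
  simp

variable [μ.Regular]

theorem induced_toLp_one (hS : IsMarkov S) (hμ : (toDual μ).comp S = toDual μ) :
    induced μ S (ContinuousMap.toLp 1 μ ℂ 1) = ContinuousMap.toLp 1 μ ℂ 1 := by
  rw [induced_toLp hS μ hμ, hS.map_one]

/-- Ergodicity means that all fixed elements of `L¹` are constant. -/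
theorem isErgodic_iff (hMarkov : ∀ S ∈ 𝒮, IsMarkov S)
    (hμ : ∀ S ∈ 𝒮, (toDual μ).comp S = toDual μ) :
    IsErgodic 𝒮 μ ↔ ∀ f : Lp ℂ 1 μ, (∀ S ∈ 𝒮, induced μ S f = f) →
      ∃ c : ℂ, c • (ContinuousMap.toLp 1 μ ℂ 1 : Lp ℂ 1 μ) = f := by
  have hmem : ∀ f : Lp ℂ 1 μ, f ∈ fixedSpace (inducedSemigroup 𝒮 μ) ↔
      ∀ S ∈ 𝒮, induced μ S f = f := fun f => by
    change (∀ T ∈ induced μ '' (𝒮 : Set _), T f = f) ↔ _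
    rw [Set.forall_mem_image]
    rfl
  let e : fixedSpace (inducedSemigroup 𝒮 μ) :=
    ⟨ContinuousMap.toLp 1 μ ℂ 1, (hmem _).2 fun S hS => induced_toLp_one (hMarkov S hS) (hμ S hS)⟩
  have he : e ≠ 0 := fun h => toLp_one_ne_zero (μ := μ) (congrArg Subtype.val h)
  rw [IsErgodic, finrank_eq_one_iff_of_nonzero' e he]
  constructor
  · intro H f hf
    obtain ⟨c, hc⟩ := H ⟨f, (hmem f).2 hf⟩
    exact ⟨c, congrArg Subtype.val hc⟩
  · rintro H ⟨f, hf⟩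
    obtain ⟨c, hc⟩ := H f ((hmem f).1 hf)
    exact ⟨c, Subtype.ext hc⟩

/-- An invariant functional dominated by an ergodic measure is a multiple of that measure. -/
theorem IsErgodic.eq_toDual_of_norm_le (hMarkov : ∀ S ∈ 𝒮, IsMarkov S)
    (hμ : ∀ S ∈ 𝒮, (toDual μ).comp S = toDual μ) (herg : IsErgodic 𝒮 μ)
    {ψ : StrongDual ℂ C(K, ℂ)} (hψ : ∀ S ∈ 𝒮, ψ.comp S = ψ) (hψ1 : ψ 1 = 1) {C : ℝ} (hC : 0 ≤ C)
    (hle : ∀ f, ‖ψ f‖ ≤ C * ∫ x, ‖f x‖ ∂μ) : ψ = toDual μ := by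
  have hdense : DenseRange (ContinuousMap.toLp 2 μ ℂ : C(K, ℂ) →L[ℂ] Lp ℂ 2 μ).toLinearMap :=
    ContinuousMap.toLp_denseRange ℂ μ ℂ ENNReal.ofNat_ne_top
  have hnorm : ∀ f, ‖ψ.toLinearMap f‖ ≤
      C * ‖(ContinuousMap.toLp 2 μ ℂ : C(K, ℂ) →L[ℂ] Lp ℂ 2 μ).toLinearMap f‖ := by
    intro f
    refine (hle f).trans (mul_le_mul_of_nonneg_left ?_ hC)
    rw [← norm_toLp_eq, ← l2ToL1_toLp]
    simpa using (l2ToL1 μ).le_of_opNorm_le (LinearMap.mkContinuous_norm_le _ zero_le_one _)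
      (ContinuousMap.toLp 2 μ ℂ f)
  -- The Riesz representative of `ψ`, which extends to `L²` because the `L¹` norm is at most the
  -- `L²` norm.
  let h := (InnerProductSpace.toDual ℂ (Lp ℂ 2 μ)).symm (ψ.toLinearMap.extendOfNorm
    (ContinuousMap.toLp 2 μ ℂ : C(K, ℂ) →L[ℂ] Lp ℂ 2 μ).toLinearMap)
  have hh : ∀ f : C(K, ℂ), inner ℂ h (ContinuousMap.toLp 2 μ ℂ f : Lp ℂ 2 μ) = ψ f := fun f => by
    rw [InnerProductSpace.toDual_symm_apply]
    exact LinearMap.extendOfNorm_eq hdense ⟨C, hnorm⟩ f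
  obtain ⟨c, hc⟩ := (isErgodic_iff hMarkov hμ).1 herg (l2ToL1 μ h) fun S hS =>
    (inner_toLp_invariant_iff (hMarkov S hS) (hμ S hS) h).1 fun f => by
      rw [hh, hh]
      exact DFunLike.congr_fun (hψ S hS) f
  have hhc : h = c • (ContinuousMap.toLp 2 μ ℂ 1 : Lp ℂ 2 μ) :=
    l2ToL1_injective (by rw [← hc, map_smul, l2ToL1_toLp])
  have hψc : ∀ f, ψ f = conj c * toDual μ f := fun f => by
    rw [← hh, hhc, inner_smul_left, inner_toLp, toDual_apply]
    congr 1
    refine integral_congr_ae ?_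
    filter_upwards [ContinuousMap.coeFn_toLp (p := 2) (𝕜 := ℂ) μ (1 : C(K, ℂ))] with x hx
    rw [hx, ContinuousMap.one_apply, map_one, mul_one]
  have hc1 : conj c = 1 := by
    have := hψc 1
    rw [hψ1, toDual_one, mul_one] at this
    exact this.symm
  ext f
  rw [hψc, hc1, one_mul]

theorem IsErgodic.mem_extremePoints (hMarkov : ∀ S ∈ 𝒮, IsMarkov S)
    (hμ : toDual μ ∈ invariantProbabilities 𝒮) (herg : IsErgodic 𝒮 μ) :
    toDual μ ∈ Set.extremePoints ℝ (invariantProbabilities 𝒮) := by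
  refine ⟨hμ, ?_⟩
  rintro φ₁ ⟨⟨μ₁, _, -, rfl⟩, hφ₁⟩ φ₂ ⟨⟨μ₂, _, -, rfl⟩, -⟩ ⟨a, b, ha, hb, -, hab⟩
  -- Domination with constant `a⁻¹`: testing `μ = a μ₁ + b μ₂` on `|f|` and dropping the second term
  -- gives `a ∫ |f| dμ₁ ≤ ∫ |f| dμ`.
  refine herg.eq_toDual_of_norm_le hMarkov hμ.2 hφ₁ toDual_one (inv_nonneg.2 ha.le) fun f => ?_
  have h1 : a * ∫ x, ‖f x‖ ∂μ₁ + b * ∫ x, ‖f x‖ ∂μ₂ = ∫ x, ‖f x‖ ∂μ := by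
    have h := DFunLike.congr_fun hab (modulus f)
    rw [add_apply, smul_apply,
      smul_apply, toDual_modulus, toDual_modulus, toDual_modulus,
      Complex.real_smul, Complex.real_smul] at h
    exact_mod_cast h
  have h2 : 0 ≤ b * ∫ x, ‖f x‖ ∂μ₂ :=
    mul_nonneg hb.le (integral_nonneg fun x => norm_nonneg _)
  rw [toDual_apply]
  refine (norm_integral_le_integral_norm _).trans ?_
  rw [← h1, mul_add, inv_mul_cancel_left₀ ha.ne']
  have := mul_nonneg (inv_nonneg.2 ha.le) h2
  linarith

/-- Bounded probability densities with respect to `μ` that are compatible with the semigroup define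
invariant probability measures. -/
theorem exists_mem_invariantProbabilities {w : K → ℝ} (hw : Measurable w) (h0 : ∀ x, 0 ≤ w x)
    {c : ℝ} (hc : ∀ x, w x ≤ c) (h1 : ∫ x, w x ∂μ = 1)
    (hinv : ∀ S ∈ 𝒮, ∀ f : C(K, ℂ), ∫ x, S f x * w x ∂μ = ∫ x, f x * w x ∂μ) :
    ∃ φ ∈ invariantProbabilities 𝒮, ∀ f, φ f = ∫ x, f x * w x ∂μ := by
  have hint : Integrable w μ := Integrable.of_bound hw.aestronglyMeasurable c
    (Filter.Eventually.of_forall fun x => by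
      rw [Real.norm_of_nonneg (h0 x)]
      exact hc x)
  let ν := μ.withDensity fun x => ENNReal.ofReal (w x)
  have hprob : IsProbabilityMeasure ν := by
    refine ⟨?_⟩
    rw [withDensity_apply _ MeasurableSet.univ, Measure.restrict_univ,
      ← ofReal_integral_eq_lintegral_ofReal hint (Filter.Eventually.of_forall h0), h1,
      ENNReal.ofReal_one]
  have hle : ν ≤ ENNReal.ofReal c • μ := by
    rw [← withDensity_const]
    exact withDensity_mono (Filter.Eventually.of_forall fun x => ENNReal.ofReal_le_ofReal (hc x))
  have hreg := Measure.InnerRegularCompactLTTop.of_le_smul ENNReal.ofReal_ne_top hle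
  have hν : ∀ f, toDual ν f = ∫ x, f x * w x ∂μ := fun f => by
    rw [toDual_apply, integral_withDensity_eq_integral_toReal_smul (by fun_prop)
      (Filter.Eventually.of_forall fun x => ENNReal.ofReal_lt_top)]
    refine integral_congr_ae (Filter.Eventually.of_forall fun x => ?_)
    simp only [ENNReal.toReal_ofReal (h0 x), Complex.real_smul, mul_comm]
  refine ⟨toDual ν, ⟨⟨ν, hprob, inferInstance, rfl⟩, fun S hS => ?_⟩, hν⟩
  ext f
  rw [ContinuousLinearMap.comp_apply, hν, hν, hinv S hS]

/-- The measures `(1 ± v) μ` have midpoint `μ`, so extremality makes `v` orthogonal to `C(K)`, which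
is dense in `L²`. The bound on `v` keeps the densities nonnegative, and mean zero keeps the mass
one. -/
theorem ae_eq_zero_of_mem_extremePoints
    (hext : toDual μ ∈ Set.extremePoints ℝ (invariantProbabilities 𝒮)) {v : K → ℝ}
    (hv : Measurable v) (hv1 : ∀ x, |v x| ≤ 1) (h0 : ∫ x, v x ∂μ = 0)
    (hinv : ∀ S ∈ 𝒮, ∀ f : C(K, ℂ), ∫ x, S f x * v x ∂μ = ∫ x, f x * v x ∂μ) :
    ∀ᵐ x ∂μ, v x = 0 := by
  have hμ := hext.1.2
  have hvL2 : MemLp (fun x => (v x : ℂ)) 2 μ :=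
    MemLp.of_bound (by fun_prop) 1 (Filter.Eventually.of_forall fun x => by simpa using hv1 x)
  have hvint : Integrable v μ := Integrable.of_bound hv.aestronglyMeasurable 1
    (Filter.Eventually.of_forall hv1)
  have hfv : ∀ f : C(K, ℂ), Integrable (fun x => f x * (v x : ℂ)) μ := fun f =>
    (integrable_continuousMap f).mul_bdd (c := 1) (by fun_prop)
      (Filter.Eventually.of_forall fun x => by simpa using hv1 x)
  have hsplit : ∀ (s : ℝ) (f : C(K, ℂ)), ∫ x, f x * ((1 + s * v x : ℝ) : ℂ) ∂μ =
      toDual μ f + s * ∫ x, f x * v x ∂μ := fun s f => by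
    rw [toDual_apply, ← integral_const_mul,
      ← integral_add (integrable_continuousMap f) ((hfv f).const_mul _)]
    refine integral_congr_ae (Filter.Eventually.of_forall fun x => ?_)
    push_cast
    ring
  have hpert : ∀ s : ℝ, |s| = 1 → ∃ φ ∈ invariantProbabilities 𝒮,
      ∀ f, φ f = toDual μ f + s * ∫ x, f x * v x ∂μ := by
    intro s hs
    have hsv : ∀ x, |s * v x| ≤ 1 := fun x => by
      rw [abs_mul, hs, one_mul]
      exact hv1 x
    obtain ⟨φ, hφ, hφf⟩ := exists_mem_invariantProbabilities (𝒮 := 𝒮) (μ := μ)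
      (w := fun x => 1 + s * v x) (by fun_prop)
      (fun x => by linarith [(abs_le.1 (hsv x)).1]) (c := 2)
      (fun x => by linarith [(abs_le.1 (hsv x)).2])
      (by
        rw [integral_add (integrable_const _) (hvint.const_mul _), integral_const_mul, h0]
        simp)
      (fun S hS f => by
        rw [hsplit, hsplit, hinv S hS]
        congr 1
        exact DFunLike.congr_fun (hμ S hS) f)
    exact ⟨φ, hφ, fun f => (hφf f).trans (hsplit s f)⟩
  obtain ⟨φ, hφ, hφf⟩ := hpert 1 (by simp)
  obtain ⟨ψ, hψ, hψf⟩ := hpert (-1) (by simp)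
  have hφμ : φ = toDual μ := by
    refine hext.2 hφ hψ ⟨1 / 2, 1 / 2, by norm_num, by norm_num, by norm_num, ?_⟩
    ext f
    rw [add_apply, smul_apply,
      smul_apply, hφf, hψf, Complex.real_smul, Complex.real_smul]
    push_cast
    ring
  have hzero : hvL2.toLp = 0 := by
    refine DenseRange.eq_zero_of_inner_left ℂ
      (ContinuousMap.toLp_denseRange ℂ μ ℂ ENNReal.ofNat_ne_top) fun f => ?_
    have h := hφf f
    rw [hφμ, Complex.ofReal_one, one_mul, left_eq_add] at h
    rw [inner_toLp, ← h]
    refine integral_congr_ae ?_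
    filter_upwards [hvL2.coeFn_toLp] with x hx
    rw [hx, Complex.conj_ofReal]
  have hae := hvL2.coeFn_toLp
  rw [hzero] at hae
  filter_upwards [hae, Lp.coeFn_zero ℂ 2 μ] with x hx hx'
  rw [hx', Pi.zero_apply] at hx
  exact_mod_cast hx.symm

/-- If `μ` is extreme, then the real parts of the fixed elements of `L¹` with mean zero are
nonpositive. -/
theorem re_mul_nonpos_of_mem_extremePoints (hMarkov : ∀ S ∈ 𝒮, IsMarkov S)
    (hext : toDual μ ∈ Set.extremePoints ℝ (invariantProbabilities 𝒮)) {f : Lp ℂ 1 μ}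
    (hf : ∀ S ∈ 𝒮, induced μ S f = f) (hf0 : ∫ x, f x ∂μ = 0) (a : ℂ) :
    ∀ᵐ x ∂μ, (a * f x).re ≤ 0 := by
  have hμ := hext.1.2
  have hfm : Measurable f := (Lp.stronglyMeasurable f).measurable
  let φ : ℝ → C(ℂ, ℝ) := fun r => ⟨fun z => max ((a * z).re - r) 0, by fun_prop⟩
  have hlip : ∀ r, LipschitzWith ‖a‖₊ fun z => (φ r z : ℂ) := fun r =>
    LipschitzWith.of_dist_le_mul fun z w => by
      rw [dist_eq_norm, ← Complex.ofReal_sub, Complex.norm_real, dist_eq_norm]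
      refine (abs_max_sub_max_le_abs _ _ _).trans ?_
      rw [sub_sub_sub_cancel_right, ← Complex.sub_re, ← mul_sub, coe_nnnorm, ← norm_mul]
      exact Complex.abs_re_le_norm _
  have h0 : ∀ r, 0 ≤ r → (φ r 0 : ℂ) = 0 := fun r hr => by simp [φ, hr]
  -- This is `min((Re af)⁺, 1)`: bounded, hence in `L²` although `f` is only in `L¹`, and a
  -- difference of two functions covered by Jensen's inequality.
  let k : K → ℝ := fun x => φ 0 (f x) - φ 1 (f x)
  have hkm : Measurable k := by fun_prop
  have hk : ∀ x, 0 ≤ k x ∧ k x ≤ 1 ∧ (k x ≤ 0 → (a * f x).re ≤ 0) ∧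
      (0 < k x → 0 < (a * f x).re) := by
    intro x
    change 0 ≤ max ((a * f x).re - 0) 0 - max ((a * f x).re - 1) 0 ∧
      max ((a * f x).re - 0) 0 - max ((a * f x).re - 1) 0 ≤ 1 ∧
      (max ((a * f x).re - 0) 0 - max ((a * f x).re - 1) 0 ≤ 0 → _) ∧
      (0 < max ((a * f x).re - 0) 0 - max ((a * f x).re - 1) 0 → _)
    grind
  have hkabs : ∀ x, |k x| ≤ 1 := fun x => abs_le.2 ⟨by linarith [(hk x).1], (hk x).2.1⟩
  have hkint : Integrable k μ :=
    Integrable.of_bound hkm.aestronglyMeasurable 1 (Filter.Eventually.of_forall hkabs)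
  have hkL2 : MemLp (fun x => (k x : ℂ)) 2 μ :=
    MemLp.of_bound (by fun_prop) 1 (Filter.Eventually.of_forall fun x => by simpa using hkabs x)
  have hkL1 : l2ToL1 μ hkL2.toLp = (hlip 0).compLp (h0 0 le_rfl) f -
      (hlip 1).compLp (h0 1 zero_le_one) f := by
    refine Lp.ext ((coeFn_l2ToL1 _).trans (hkL2.coeFn_toLp.trans ?_))
    filter_upwards [Lp.coeFn_sub ((hlip 0).compLp (h0 0 le_rfl) f)
      ((hlip 1).compLp (h0 1 zero_le_one) f), (hlip 0).coeFn_compLp (h0 0 le_rfl) f,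
      (hlip 1).coeFn_compLp (h0 1 zero_le_one) f] with x hx hx0 hx1
    rw [hx, Pi.sub_apply, hx0, hx1]
    exact Complex.ofReal_sub _ _
  have hkinv : ∀ S ∈ 𝒮, ∀ g : C(K, ℂ), ∫ x, S g x * k x ∂μ = ∫ x, g x * k x ∂μ := by
    intro S hS g
    have hin : ∀ g : C(K, ℂ), ∫ x, g x * k x ∂μ =
        inner ℂ hkL2.toLp (ContinuousMap.toLp 2 μ ℂ g : Lp ℂ 2 μ) := fun g => by
      rw [inner_toLp]
      refine integral_congr_ae ?_
      filter_upwards [hkL2.coeFn_toLp] with x hx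
      rw [hx, Complex.conj_ofReal]
    rw [hin, hin]
    refine (inner_toLp_invariant_iff (hMarkov S hS) (hμ S hS) _).2 ?_ g
    rw [hkL1, map_sub]
    congr 1 <;>
    exact induced_compLp_eq (hMarkov S hS) (hμ S hS) _ _ ((hMarkov S hS).max_le a _) (hf S hS)
  let κ := ∫ x, k x ∂μ
  have hκ0 : 0 ≤ κ := integral_nonneg fun x => (hk x).1
  have hκ1 : κ ≤ 1 := by
    have := integral_mono hkint (integrable_const (1 : ℝ)) fun x => (hk x).2.1
    simpa using this
  have hkκ : ∀ᵐ x ∂μ, k x - κ = 0 := by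
    refine ae_eq_zero_of_mem_extremePoints hext (by fun_prop) (fun x => ?_) ?_ ?_
    · exact abs_le.2 ⟨by linarith [(hk x).1], by linarith [(hk x).2.1]⟩
    · rw [integral_sub hkint (integrable_const _)]
      simp [κ]
    · have hgk : ∀ g : C(K, ℂ), ∫ x, g x * ((k x - κ : ℝ) : ℂ) ∂μ =
          ∫ x, g x * k x ∂μ - κ * toDual μ g := fun g => by
        rw [toDual_apply, ← integral_const_mul, ← integral_sub
          ((integrable_continuousMap g).mul_bdd (c := 1) (by fun_prop)
            (Filter.Eventually.of_forall fun x => by simpa using hkabs x))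
          ((integrable_continuousMap g).const_mul _)]
        refine integral_congr_ae (Filter.Eventually.of_forall fun x => ?_)
        push_cast
        ring
      intro S hS g
      rw [hgk, hgk, hkinv S hS]
      congr 2
      exact DFunLike.congr_fun (hμ S hS) g
  -- If `κ = 0`, then `k` vanishes a.e. and `Re af ≤ 0`. If `κ > 0`, then `Re af` is positive a.e.
  -- with integral zero, hence zero a.e.
  rcases hκ0.eq_or_lt with hκ | hκ
  · filter_upwards [hkκ] with x hx
    exact (hk x).2.2.1 (by linarith)
  · have hint : Integrable (fun x => a * f x) μ := (L1.integrable_coeFn f).const_mul a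
    have hpos : ∀ᵐ x ∂μ, 0 < (a * f x).re := by
      filter_upwards [hkκ] with x hx
      exact (hk x).2.2.2 (by linarith)
    have hzero : ∫ x, (a * f x).re ∂μ = 0 := by
      have h := integral_re hint
      rw [integral_const_mul, hf0, mul_zero] at h
      simpa using h
    filter_upwards [(integral_eq_zero_iff_of_nonneg_ae (hpos.mono fun x hx => hx.le)
      hint.re).1 hzero] with x hx
    exact hx.le

theorem isErgodic_of_mem_extremePoints (hMarkov : ∀ S ∈ 𝒮, IsMarkov S)
    (hext : toDual μ ∈ Set.extremePoints ℝ (invariantProbabilities 𝒮)) : IsErgodic 𝒮 μ := by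
  have hμ := hext.1.2
  refine (isErgodic_iff hMarkov hμ).2 fun f hf => ?_
  let c := ∫ x, f x ∂μ
  let e : Lp ℂ 1 μ := ContinuousMap.toLp 1 μ ℂ 1
  refine ⟨c, (sub_eq_zero.1 ?_).symm⟩
  have hfix : ∀ S ∈ 𝒮, induced μ S (f - c • e) = f - c • e := fun S hS => by
    rw [map_sub, map_smul, hf S hS, induced_toLp_one (hMarkov S hS) (hμ S hS)]
  have hcoe : ∀ᵐ x ∂μ, (f - c • e) x = f x - c := by
    filter_upwards [Lp.coeFn_sub f (c • e), Lp.coeFn_smul c e,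
      ContinuousMap.coeFn_toLp (p := 1) (𝕜 := ℂ) μ (1 : C(K, ℂ))] with x hx hx' hx1
    rw [hx, Pi.sub_apply, hx', Pi.smul_apply, hx1]
    simp
  have h0 : ∫ x, (f - c • e) x ∂μ = 0 := by
    rw [integral_congr_ae hcoe, integral_sub (L1.integrable_coeFn f) (integrable_const c)]
    simp [c]
  -- The multipliers `1`, `-1`, `I`, `-I` bound the real and imaginary parts from both sides by
  -- zero.
  have hre := re_mul_nonpos_of_mem_extremePoints hMarkov hext hfix h0
  refine Lp.ext ?_
  filter_upwards [hre 1, hre (-1), hre Complex.I, hre (-Complex.I), Lp.coeFn_zero ℂ 1 μ]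
    with x h1 h2 h3 h4 h5
  rw [h5]
  simp only [one_mul, neg_mul, Complex.neg_re, Complex.I_mul_re] at h1 h2 h3 h4
  exact Complex.ext (by simp only [Pi.zero_apply, Complex.zero_re]; linarith)
    (by simp only [Pi.zero_apply, Complex.zero_im]; linarith)

end Ergodic

end MarkovSemigroup

theorem proposition2p3 {K : Type*} [TopologicalSpace K] [CompactSpace K] [T2Space K]
    [MeasurableSpace K] [BorelSpace K]
    (𝒮 : Subsemigroup (C(K, ℂ) →L[ℂ] C(K, ℂ)))
    (hMarkov : ∀ S ∈ 𝒮, MarkovSemigroup.IsMarkov S)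
    (hAmenable : MarkovSemigroup.IsRightAmenable 𝒮)
    (μ : Measure K) [IsProbabilityMeasure μ] [μ.Regular]
    (hμ : MarkovSemigroup.toDual μ ∈ MarkovSemigroup.invariantProbabilities 𝒮) :
    MarkovSemigroup.IsErgodic 𝒮 μ ↔
      MarkovSemigroup.toDual μ ∈
        Set.extremePoints ℝ (MarkovSemigroup.invariantProbabilities 𝒮) :=
  ⟨fun h => h.mem_extremePoints hMarkov hμ,
    MarkovSemigroup.isErgodic_of_mem_extremePoints hMarkov⟩
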